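/- Let $\mathbf W=\{\mathbf W(t_1,t_2):(t_1,t_2)\in[0,1]^2\}$ be a standard Brownian sheet on a probability space $(\Omega,\mathcal F,\mathbb P)$, that is, a centered Gaussian process with $\mathbb E[\mathbf W(t_1,t_2)\mathbf W(s_1,s_2)]=(t_1\wedge s_1)(t_2\wedge s_2)$, whose paths are, up to a null set of $\omega$, those of a jointly measurable process (for instance, are almost surely continuous). Put $$\mathbf B(t_1,t_2)=\mathbf W(t_1,t_2)-t_1t_2\mathbf W(1,1),$$ $$\mathbf B_0(t_1,t_2)=\mathbf W(t_1,t_2)-t_1\mathbf W(1,t_2)-t_2\mathbf W(t_1,1)+t_1t_2\mathbf W(1,1),$$ $$\mathbf K^{(1)}(t_1,t_2)=\mathbf W(t_1,t_2)-t_1\mathbf W(1,t_2),\qquad \mathbf K^{(2)}(t_1,t_2)=\mathbf W(t_1,t_2)-t_2\mathbf W(t_1,1).$$ Then, almost surely, $\mathbf W$, $\mathbf B$, $\mathbf B_0$, $\mathbf K^{(1)}$, $\mathbf K^{(2)}$ and the four centred fields in square brackets below belong to $L^2([0,1]^2)$ (the partial means $\int_0^1\mathbf W(t_1,u_2)\,du_2$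 and $\int_0^1\mathbf W(u_1,t_2)\,du_1$ existing for almost every $t_1$, respectively almost every $t_2$), and the following identities in law hold: $$\int_{[0,1]^2}\mathbf B(t_1,t_2)^2\,dt_1dt_2\overset{law}{=}\int_{[0,1]^2}\Big[\mathbf W(t_1,t_2)-\int_{[0,1]^2}\mathbf W(u_1,u_2)\,du_1du_2\Big]^2dt_1dt_2,$$ $$\int_{[0,1]^2}\mathbf B_0(t_1,t_2)^2\,dt_1dt_2\overset{law}{=}\int_{[0,1]^2}\Big[\mathbf W(t_1,t_2)-\int_0^1\mathbf W(t_1,u_2)\,du_2-\int_0^1\mathbf W(u_1,t_2)\,du_1+\int_{[0,1]^2}\mathbf W(u_1,u_2)\,du_1du_2\Big]^2dt_1dt_2,$$ $$\int_{[0,1]^2}\mathbf K^{(1)}(t_1,t_2)^2\,dt_1dt_2\overset{law}{=}\int_{[0,1]^2}\Big[\mathbf W(t_1,t_2)-\int_0^1\mathbf W(u_1,t_2)\,du_1\Big]^2dt_1dt_2,$$ $$\int_{[0,1]^2}\mathbf K^{(2)}(t_1,t_2)^2\,dt_1dt_2\overset{law}{=}\int_{[0,1]^2}\Big[\mathbf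 W(t_1,t_2)-\int_0^1\mathbf W(t_1,u_2)\,du_2\Big]^2dt_1dt_2.$$ -/

import Mathlib

open MeasureTheory ProbabilityTheory unitInterval

namespace BrownianSheet

variable {Ω : Type*} [MeasurableSpace Ω]

/-- A standard Brownian sheet on `[0,1]²` vanishing on the axes: a centered Gaussian process with
`E[W(t₁,t₂) W(s₁,s₂)] = (t₁ ∧ s₁) (t₂ ∧ s₂)`. -/
structure IsBrownianSheet (W : I × I → Ω → ℝ) (P : Measure Ω) : Prop where
  isGaussianProcess : IsGaussianProcess W P
  centered : ∀ t, ∫ ω, W t ω ∂P = 0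
  covariance : ∀ t s, ∫ ω, W t ω * W s ω ∂P =
    min (t.1 : ℝ) (s.1 : ℝ) * min (t.2 : ℝ) (s.2 : ℝ)

/-- The paths of `W` are, outside one null set of `ω`, those of a jointly measurable process.
Every jointly measurable process and every process of random variables with almost surely
continuous paths satisfies this. -/
def HasMeasurablePaths (W : I × I → Ω → ℝ) (P : Measure Ω) : Prop :=
  ∃ W' : I × I → Ω → ℝ, Measurable (fun p : (I × I) × Ω ↦ W' p.1 p.2) ∧
    ∀ᵐ ω ∂P, ∀ t, W t ω = W' t ω

/-- The canonical bivariate Brownian bridge `𝐁` associated to `W`. -/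
noncomputable def bridge (W : I × I → Ω → ℝ) (t : I × I) (ω : Ω) : ℝ :=
  W t ω - (t.1 : ℝ) * (t.2 : ℝ) * W (1, 1) ω

/-- The canonical bivariate tied down Brownian bridge `𝐁₀` associated to `W`. -/
noncomputable def tiedDownBridge (W : I × I → Ω → ℝ) (t : I × I) (ω : Ω) : ℝ :=
  W t ω - (t.1 : ℝ) * W (1, t.2) ω - (t.2 : ℝ) * W (t.1, 1) ω
    + (t.1 : ℝ) * (t.2 : ℝ) * W (1, 1) ω

/-- The first canonical Kiefer field `𝐊(·,1)` associated to `W`. -/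
noncomputable def kieferOne (W : I × I → Ω → ℝ) (t : I × I) (ω : Ω) : ℝ :=
  W t ω - (t.1 : ℝ) * W (1, t.2) ω

/-- The second canonical Kiefer field `𝐊(·,2)` associated to `W`. -/
noncomputable def kieferTwo (W : I × I → Ω → ℝ) (t : I × I) (ω : Ω) : ℝ :=
  W t ω - (t.2 : ℝ) * W (t.1, 1) ω

/-- `W` centred by its full mean. -/
noncomputable def centred (W : I × I → Ω → ℝ) (t : I × I) (ω : Ω) : ℝ :=
  W t ω - ∫ u : I × I, W u ω

/-- `W` doubly centred. -/
noncomputable def doublyCentred (W : I × I → Ω → ℝ) (t : I × I) (ω : Ω) : ℝ :=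
  W t ω - (∫ u₂ : I, W (t.1, u₂) ω) - (∫ u₁ : I, W (u₁, t.2) ω) + ∫ u : I × I, W u ω

/-- `W` centred by its mean in the first variable. -/
noncomputable def centredOne (W : I × I → Ω → ℝ) (t : I × I) (ω : Ω) : ℝ :=
  W t ω - ∫ u₁ : I, W (u₁, t.2) ω

/-- `W` centred by its mean in the second variable. -/
noncomputable def centredTwo (W : I × I → Ω → ℝ) (t : I × I) (ω : Ω) : ℝ :=
  W t ω - ∫ u₂ : I, W (t.1, u₂) ω

/-- Almost surely, the path of the random field `Z` is in `L²([0,1]²)`. -/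
def HasSquareIntegrablePaths (Z : I × I → Ω → ℝ) (P : Measure Ω) : Prop :=
  ∀ᵐ ω ∂P, MemLp (fun t : I × I ↦ Z t ω) 2 volume

end BrownianSheet

open BrownianSheet

/-!
All four identities are instances of one statement with three real parameters `a`, `b`, `c`: the
fields `bridgeComb a b c`, namely `W - a t₁ W(1,t₂) - b t₂ W(t₁,1) + c t₁t₂ W(1,1)`, and
`meanComb a b c`, namely `W - a ∫ W du₁ - b ∫ W du₂ + c ∫∫ W`, have square integrals with the same
law.

Write `W = S ξ` with `ξ` white noise on `[0,1]²` and `S` the integration operator, and let `Q` be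
`1 - a p ⊗ 1 - b 1 ⊗ p + c p ⊗ p`, where `p` is the averaging projection onto constants in one
variable. Then `bridgeComb` is `S Q ξ`, since `t ↦ t f(1)` is the integral of the mean of `f'`, and
`meanComb` is `Q S ξ`. Time reversal `t ↦ 1 - t` in both variables commutes with `Q` and carries `S`
to its adjoint, so the covariance `Q S S* Q` is unitarily equivalent to `Q S* S Q = (S Q)* (S Q)`,
which has the same nonzero spectrum as the covariance `(S Q) (S Q)*` of the bridge. The law of
the squared norm of a centered Gaussian vector depends only on the spectrum of its covariance.

This argument is carried out exactly on the grid of mesh `1 / (n + 1)`, where the values of `W` are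
partial sums of white noise and `S`, `Q` are matrices: `charpoly_kroneckerComb` compares the
spectra, `identDistrib_sum_sq` turns this into an identity in law, and
`IsBrownianSheet.identDistrib_roundUp` expresses the result as the identity for the step functions
obtained by rounding up the parameters to the grid. The increments of `W` over a cell are small in
`L²(P)` uniformly in the parameter, so both square integrals converge in `L¹(P)`
(`tendstoInMeasure_integral_sq`) as `n → ∞`, and the identity passes to the limit
(`IsBrownianSheet.identDistrib_of_measurable`).
-/

namespace BrownianSheet

/-! ### Gaussian vectors with isospectral covariances -/

section GaussianVectors

variable {Ω Ω' ι : Type*} [MeasurableSpace Ω] [MeasurableSpace Ω'] [Fintype ι]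
  {P : Measure Ω} {P' : Measure Ω'}

theorem integral_sum_mul_sq {g : ι → Ω → ℝ} (hg : ∀ i, MemLp (g i) 2 P) (x : ι → ℝ) :
    ∫ ω, (∑ i, x i * g i ω) ^ 2 ∂P = ∑ i, ∑ j, x i * x j * ∫ ω, g i ω * g j ω ∂P := by
  have hint : ∀ i j, Integrable (fun ω ↦ x i * x j * (g i ω * g j ω)) P := fun i j ↦
    ((hg i).integrable_mul (hg j)).const_mul _
  calc ∫ ω, (∑ i, x i * g i ω) ^ 2 ∂P
      = ∫ ω, ∑ i, ∑ j, x i * x j * (g i ω * g j ω) ∂P := by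
        congr 1 with ω
        rw [sq, Finset.sum_mul_sum]
        exact Finset.sum_congr rfl fun i _ ↦ Finset.sum_congr rfl fun j _ ↦ by ring
    _ = _ := by
        rw [integral_finsetSum _ fun i _ ↦ integrable_finsetSum _ fun j _ ↦ hint i j]
        refine Finset.sum_congr rfl fun i _ ↦ ?_
        rw [integral_finsetSum _ fun j _ ↦ hint i j]
        exact Finset.sum_congr rfl fun j _ ↦ integral_const_mul _ _

/-- A centered Gaussian vector is determined in law by its covariance. -/
theorem identDistrib_of_integral_mul_eq {g : ι → Ω → ℝ} {h : ι → Ω' → ℝ}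
    (hg : HasGaussianLaw (fun ω ↦ (g · ω)) P) (hh : HasGaussianLaw (fun ω ↦ (h · ω)) P')
    (hg0 : ∀ i, ∫ ω, g i ω ∂P = 0) (hh0 : ∀ i, ∫ ω, h i ω ∂P' = 0)
    (hcov : ∀ i j, ∫ ω, g i ω * g j ω ∂P = ∫ ω, h i ω * h j ω ∂P') :
    IdentDistrib (fun ω ↦ (g · ω)) (fun ω ↦ (h · ω)) P P' := by
  classical
  have := hg.isProbabilityMeasure
  have := hh.isProbabilityMeasure
  have hL : ∀ (L : StrongDual ℝ (ι → ℝ)) (v : ι → ℝ), L v = ∑ i, L (Pi.single i 1) * v i := by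
    intro L v
    conv_lhs => rw [← Finset.univ_sum_single v]
    rw [map_sum]
    refine Finset.sum_congr rfl fun i _ ↦ ?_
    rw [mul_comm, ← smul_eq_mul, ← map_smul, ← Pi.single_smul, smul_eq_mul, mul_one]
  refine ⟨hg.aemeasurable, hh.aemeasurable, ?_⟩
  have := hg.isGaussian_map
  have := hh.isGaussian_map
  refine Measure.ext_of_charFunDual (funext fun L ↦ ?_)
  -- Abstracting the coefficients keeps `simp` from rewriting `L (Pi.single i 1)` again.
  obtain ⟨l, hl⟩ : ∃ l : ι → ℝ, ∀ v, L v = ∑ i, l i * v i := ⟨_, hL L⟩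
  rw [hg.charFunDual_map_eq, hh.charFunDual_map_eq]
  have m1 : ∫ ω, (L ∘ fun ω ↦ (g · ω)) ω ∂P = 0 := by
    simp only [Function.comp_apply, hl]
    rw [integral_finsetSum _ fun i _ ↦ (hg.eval i).integrable.const_mul _]
    simp [integral_const_mul, hg0]
  have m2 : ∫ ω, (L ∘ fun ω ↦ (h · ω)) ω ∂P' = 0 := by
    simp only [Function.comp_apply, hl]
    rw [integral_finsetSum _ fun i _ ↦ (hh.eval i).integrable.const_mul _]
    simp [integral_const_mul, hh0]
  have v1 := variance_of_integral_eq_zero (hg.map L).aemeasurable m1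
  have v2 := variance_of_integral_eq_zero (hh.map L).aemeasurable m2
  rw [m1, m2, v1, v2]
  simp only [Function.comp_apply, hl]
  rw [integral_sum_mul_sq (fun i ↦ (hg.eval i).memLp_two),
    integral_sum_mul_sq (fun i ↦ (hh.eval i).memLp_two)]
  simp only [hcov]

theorem hasGaussianLaw_mulVec {κ : Type*} [Fintype κ] {g : ι → Ω → ℝ}
    (hg : HasGaussianLaw (fun ω ↦ (g · ω)) P) (A : Matrix κ ι ℝ) :
    HasGaussianLaw (fun ω ↦ (A.mulVec (g · ω) ·)) P :=
  hg.map_fun (LinearMap.toContinuousLinearMap A.mulVecLin)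

theorem integral_mulVec {κ : Type*} {g : ι → Ω → ℝ} (hg : ∀ i, Integrable (g i) P)
    (hg0 : ∀ i, ∫ ω, g i ω ∂P = 0) (A : Matrix κ ι ℝ) (k : κ) :
    ∫ ω, A.mulVec (g · ω) k ∂P = 0 := by
  simp only [Matrix.mulVec, dotProduct]
  rw [integral_finsetSum _ fun i _ ↦ (hg i).const_mul _]
  simp [integral_const_mul, hg0]

/-- The matrix of second moments of a random vector; for a centered vector, its covariance. -/
noncomputable def momentMatrix (g : ι → Ω → ℝ) (P : Measure Ω) : Matrix ι ι ℝ :=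
  Matrix.of fun i j ↦ ∫ ω, g i ω * g j ω ∂P

theorem momentMatrix_mulVec {κ : Type*} [Fintype κ] {g : ι → Ω → ℝ}
    (hg : ∀ i, MemLp (g i) 2 P) (A : Matrix κ ι ℝ) :
    momentMatrix (fun k ω ↦ A.mulVec (g · ω) k) P = A * momentMatrix g P * A.transpose := by
  ext k l
  have hint : ∀ i j, Integrable (fun ω ↦ A k i * A l j * (g i ω * g j ω)) P := fun i j ↦
    ((hg i).integrable_mul (hg j)).const_mul _
  simp only [momentMatrix, Matrix.of_apply, Matrix.mulVec, dotProduct, Matrix.mul_apply,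
    Matrix.transpose_apply]
  calc ∫ ω, (∑ i, A k i * g i ω) * (∑ j, A l j * g j ω) ∂P
      = ∫ ω, ∑ j, ∑ i, A k i * A l j * (g i ω * g j ω) ∂P := by
        congr 1 with ω
        rw [Finset.sum_mul_sum, Finset.sum_comm]
        exact Finset.sum_congr rfl fun i _ ↦ Finset.sum_congr rfl fun j _ ↦ by ring
    _ = _ := by
        rw [integral_finsetSum _ fun i _ ↦ integrable_finsetSum _ fun j _ ↦ hint j i]
        refine Finset.sum_congr rfl fun i _ ↦ ?_
        rw [integral_finsetSum _ fun j _ ↦ hint j i, Finset.sum_mul]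
        refine Finset.sum_congr rfl fun j _ ↦ ?_
        rw [integral_const_mul]
        ring

/-- Rotating both vectors into eigenbases of their covariances turns each into a Gaussian vector
whose covariance is the diagonal matrix of the common eigenvalues. -/
theorem identDistrib_sum_sq [DecidableEq ι] {g : ι → Ω → ℝ} {h : ι → Ω' → ℝ}
    (hg : HasGaussianLaw (fun ω ↦ (g · ω)) P) (hh : HasGaussianLaw (fun ω ↦ (h · ω)) P')
    (hg0 : ∀ i, ∫ ω, g i ω ∂P = 0) (hh0 : ∀ i, ∫ ω, h i ω ∂P' = 0)
    (hcov : (momentMatrix g P).charpoly = (momentMatrix h P').charpoly) :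
    IdentDistrib (fun ω ↦ ∑ i, g i ω ^ 2) (fun ω ↦ ∑ i, h i ω ^ 2) P P' := by
  have hC : (momentMatrix g P).IsHermitian := by
    ext i j; simp [momentMatrix, mul_comm]
  have hD : (momentMatrix h P').IsHermitian := by
    ext i j; simp [momentMatrix, mul_comm]
  have hev := (Matrix.IsHermitian.eigenvalues_eq_eigenvalues_iff hC hD).2 hcov
  -- Rotations preserve the sum of squares.
  have key : ∀ (U : Matrix.unitaryGroup ι ℝ) (v : ι → ℝ),
      ∑ i, v i ^ 2 = ∑ i, ((U : Matrix ι ι ℝ).transpose.mulVec v i) ^ 2 := by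
    intro U v
    have hU : (U : Matrix ι ι ℝ) * (U : Matrix ι ι ℝ).transpose = 1 := by
      have := Matrix.mem_unitaryGroup_iff.1 U.2
      rwa [Matrix.star_eq_conjTranspose, Matrix.conjTranspose_eq_transpose_of_trivial] at this
    have : v ⬝ᵥ v = ((U : Matrix ι ι ℝ).transpose.mulVec v) ⬝ᵥ
        ((U : Matrix ι ι ℝ).transpose.mulVec v) := by
      rw [Matrix.dotProduct_mulVec, Matrix.vecMul_transpose, Matrix.mulVec_mulVec, hU,
        Matrix.one_mulVec]
    simpa [dotProduct, sq] using this
  have diag : ∀ {A : Matrix ι ι ℝ} (hA : A.IsHermitian),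
      (hA.eigenvectorUnitary : Matrix ι ι ℝ).transpose * A *
        (hA.eigenvectorUnitary : Matrix ι ι ℝ) = Matrix.diagonal hA.eigenvalues := by
    intro A hA
    have hU := Matrix.mem_unitaryGroup_iff'.1 hA.eigenvectorUnitary.2
    rw [Matrix.star_eq_conjTranspose, Matrix.conjTranspose_eq_transpose_of_trivial] at hU
    have h1 := hA.spectral_theorem
    rw [Unitary.conjStarAlgAut_apply] at h1
    simp only [Matrix.star_eq_conjTranspose, Matrix.conjTranspose_eq_transpose_of_trivial] at h1
    generalize (hA.eigenvectorUnitary : Matrix ι ι ℝ) = U at h1 hU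
    generalize hA.eigenvalues = ev at h1
    rw [h1]
    simp only [Matrix.mul_assoc, hU, Matrix.mul_one]
    rw [← Matrix.mul_assoc, hU, Matrix.one_mul]
    rfl
  have hI := identDistrib_of_integral_mul_eq
    (hasGaussianLaw_mulVec hg (hC.eigenvectorUnitary : Matrix ι ι ℝ).transpose)
    (hasGaussianLaw_mulVec hh (hD.eigenvectorUnitary : Matrix ι ι ℝ).transpose)
    (integral_mulVec (fun i ↦ (hg.eval i).integrable) hg0 _)
    (integral_mulVec (fun i ↦ (hh.eval i).integrable) hh0 _) (by
      intro i j
      have e1 := momentMatrix_mulVec (fun i ↦ (hg.eval i).memLp_two)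
        (hC.eigenvectorUnitary : Matrix ι ι ℝ).transpose
      have e2 := momentMatrix_mulVec (fun i ↦ (hh.eval i).memLp_two)
        (hD.eigenvectorUnitary : Matrix ι ι ℝ).transpose
      rw [Matrix.transpose_transpose, diag] at e1 e2
      exact congrFun₂ (e1.trans ((congrArg _ hev).trans e2.symm)) i j)
  have := hI.comp (u := fun v : ι → ℝ ↦ ∑ i, v i ^ 2) (by fun_prop)
  convert this using 1
  · ext ω; exact key _ _
  · ext ω; exact key _ _

end GaussianVectors

/-! ### Discrete bridges and centrings as matrices -/

section Matrices

open Matrix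
open scoped Kronecker

/-- If `L S = S Q`, and reversing the index order fixes the symmetric matrix `Q` and transposes `S`,
then `L S` and `Q S` have the same singular values. -/
theorem charpoly_eq_of_reversal {ι : Type*} [Fintype ι] [DecidableEq ι] {L S Q : Matrix ι ι ℝ}
    (r : ι ≃ ι) (hLS : L * S = S * Q) (hQ : Qᵀ = Q) (hQr : Q.submatrix r r = Q)
    (hSr : S.submatrix r r = Sᵀ) (c : ℝ) :
    (L * (c • (S * Sᵀ)) * Lᵀ).charpoly = (Q * (c • (S * Sᵀ)) * Qᵀ).charpoly := by
  have h1 : L * (c • (S * Sᵀ)) * Lᵀ = (S * Q) * (c • (S * Q)ᵀ) := by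
    rw [← hLS, transpose_mul]
    simp only [Matrix.mul_assoc, Matrix.mul_smul, Matrix.smul_mul]
  have hSr' : Sᵀ.submatrix r r = S := by
    rw [← transpose_submatrix, hSr, transpose_transpose]
  have hmul : ∀ A B : Matrix ι ι ℝ,
      (A * B).submatrix r r = A.submatrix r r * B.submatrix r r := fun A B ↦
    (submatrix_mul_equiv A B r r r).symm
  have hsmul : ∀ A : Matrix ι ι ℝ, (c • A).submatrix r r = c • A.submatrix r r := fun _ ↦ rfl
  have h2 : (Q * (c • (S * Sᵀ)) * Qᵀ).submatrix r r = (c • (S * Q)ᵀ) * (S * Q) := by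
    rw [hQ, hmul, hmul, hsmul, hmul, hQr, hSr, hSr', transpose_mul, hQ]
    simp only [Matrix.mul_assoc, Matrix.mul_smul, Matrix.smul_mul]
  have h3 := charpoly_reindex r.symm (Q * (c • (S * Sᵀ)) * Qᵀ)
  rw [reindex_apply, Equiv.symm_symm, h2] at h3
  rw [h1, ← h3]
  exact charpoly_mul_comm _ _

variable (n : ℕ)

/-- The summation matrix: `(sumMatrix n *ᵥ x) i = ∑ j ≤ i, x j`. -/
def sumMatrix : Matrix (Fin (n + 1)) (Fin (n + 1)) ℝ := of fun i j ↦ if j ≤ i then 1 else 0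

/-- The matrix of the averaging projection onto the constant vectors. -/
noncomputable def meanMatrix : Matrix (Fin (n + 1)) (Fin (n + 1)) ℝ :=
  of fun _ _ ↦ 1 / ((n : ℝ) + 1)

/-- The matrix of `x ↦ (i ↦ (i + 1) / (n + 1) * x (last n))`, the chord that a discrete bridge
subtracts from its path. -/
noncomputable def chordMatrix : Matrix (Fin (n + 1)) (Fin (n + 1)) ℝ :=
  of fun i j ↦ if j = Fin.last n then ((i : ℝ) + 1) / ((n : ℝ) + 1) else 0

/-- Subtracting the chord from the partial sums of `x` amounts to summing the centred `x`. -/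
theorem chordMatrix_mul_sumMatrix :
    chordMatrix n * sumMatrix n = sumMatrix n * meanMatrix n := by
  ext i j
  have h1 : (chordMatrix n * sumMatrix n) i j = ((i : ℝ) + 1) / ((n : ℝ) + 1) := by
    simp only [mul_apply, chordMatrix, sumMatrix, of_apply, ite_mul, zero_mul]
    rw [Finset.sum_ite_eq' Finset.univ (Fin.last n)]
    simp [Fin.le_last]
  have h2 : (sumMatrix n * meanMatrix n) i j = ((i : ℝ) + 1) / ((n : ℝ) + 1) := by
    have : (Finset.univ.filter fun k : Fin (n + 1) ↦ k ≤ i).card = (i : ℕ) + 1 := by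
      rw [← Fin.card_Iic]; congr 1; ext; simp
    simp only [mul_apply, meanMatrix, sumMatrix, of_apply]
    rw [← Finset.sum_mul, Finset.sum_boole, this]
    push_cast
    ring
  rw [h1, h2]

/-- Partial sums of white noise have the covariance of Brownian motion. -/
theorem sumMatrix_mul_transpose (i j : Fin (n + 1)) :
    (sumMatrix n * (sumMatrix n)ᵀ) i j = min ((i : ℝ) + 1) ((j : ℝ) + 1) := by
  have : (Finset.univ.filter fun k : Fin (n + 1) ↦ k ≤ i ∧ k ≤ j).card = min (i : ℕ) j + 1 := by
    have h := Fin.card_Iic (min i j)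
    rw [Fin.coe_min] at h
    rw [← h]; congr 1; ext; simp
  simp only [sumMatrix, mul_apply, transpose_apply, of_apply, ite_mul, one_mul, zero_mul, ← ite_and,
    Finset.sum_boole, this]
  rw [min_add_add_right]; push_cast; rfl

/-- The Kronecker combination `1 - a A ⊗ 1 - b 1 ⊗ A + c A ⊗ A`. -/
def kroneckerComb {n : ℕ} (a b c : ℝ) (A : Matrix (Fin (n + 1)) (Fin (n + 1)) ℝ) :
    Matrix (Fin (n + 1) × Fin (n + 1)) (Fin (n + 1) × Fin (n + 1)) ℝ :=
  1 - a • (A ⊗ₖ 1) - b • (1 ⊗ₖ A) + c • (A ⊗ₖ A)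

/-- The discrete bridge `kroneckerComb a b c (chordMatrix n)` and the discrete centring
`kroneckerComb a b c (meanMatrix n)` have covariances with the same characteristic polynomial. -/
theorem charpoly_kroneckerComb (a b c d : ℝ) :
    (kroneckerComb a b c (chordMatrix n) *
      (d • ((sumMatrix n ⊗ₖ sumMatrix n) * (sumMatrix n ⊗ₖ sumMatrix n)ᵀ)) *
        (kroneckerComb a b c (chordMatrix n))ᵀ).charpoly =
    (kroneckerComb a b c (meanMatrix n) *
      (d • ((sumMatrix n ⊗ₖ sumMatrix n) * (sumMatrix n ⊗ₖ sumMatrix n)ᵀ)) *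
        (kroneckerComb a b c (meanMatrix n))ᵀ).charpoly := by
  refine charpoly_eq_of_reversal (Fin.revPerm.prodCongr Fin.revPerm) ?_ ?_ ?_ ?_ d
  · simp only [kroneckerComb, Matrix.add_mul, Matrix.sub_mul, Matrix.mul_add, Matrix.mul_sub,
      Matrix.smul_mul, Matrix.mul_smul, ← mul_kronecker_mul, chordMatrix_mul_sumMatrix,
      Matrix.one_mul, Matrix.mul_one]
  · ext ⟨i, j⟩ ⟨k, l⟩
    simp [kroneckerComb, meanMatrix, Matrix.one_apply, eq_comm]
  · ext ⟨i, j⟩ ⟨k, l⟩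
    simp [kroneckerComb, meanMatrix, Matrix.one_apply]
  · ext ⟨i, j⟩ ⟨k, l⟩
    simp [sumMatrix]

theorem kroneckerComb_chordMatrix_mulVec (a b c : ℝ) (w : Fin (n + 1) × Fin (n + 1) → ℝ)
    (i j : Fin (n + 1)) :
    (kroneckerComb a b c (chordMatrix n) *ᵥ w) (i, j) =
      w (i, j) - a * (((i : ℝ) + 1) / ((n : ℝ) + 1) * w (Fin.last n, j))
        - b * (((j : ℝ) + 1) / ((n : ℝ) + 1) * w (i, Fin.last n))
        + c * (((i : ℝ) + 1) / ((n : ℝ) + 1) * (((j : ℝ) + 1) / ((n : ℝ) + 1)) *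
          w (Fin.last n, Fin.last n)) := by
  simp only [kroneckerComb, add_mulVec, sub_mulVec, smul_mulVec, one_mulVec, Pi.add_apply,
    Pi.sub_apply, Pi.smul_apply, smul_eq_mul]
  simp [mulVec, dotProduct, Fintype.sum_prod_type, chordMatrix, Matrix.one_apply]

theorem kroneckerComb_meanMatrix_mulVec (a b c : ℝ) (w : Fin (n + 1) × Fin (n + 1) → ℝ)
    (i j : Fin (n + 1)) :
    (kroneckerComb a b c (meanMatrix n) *ᵥ w) (i, j) =
      w (i, j) - a * (1 / ((n : ℝ) + 1) * ∑ k, w (k, j))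
        - b * (1 / ((n : ℝ) + 1) * ∑ l, w (i, l))
        + c * (1 / ((n : ℝ) + 1) * ∑ k, 1 / ((n : ℝ) + 1) * ∑ l, w (k, l)) := by
  simp only [kroneckerComb, add_mulVec, sub_mulVec, smul_mulVec, one_mulVec, Pi.add_apply,
    Pi.sub_apply, Pi.smul_apply, smul_eq_mul]
  simp [mulVec, dotProduct, Fintype.sum_prod_type, meanMatrix, Matrix.one_apply, Finset.mul_sum,
    mul_assoc]

end Matrices

/-! ### The two families of fields and the grid -/

/-- The field `w(t) - a t₁ w(1,t₂) - b t₂ w(t₁,1) + c t₁t₂ w(1,1)`; the bridge, the tied down bridge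
and the two Kiefer fields are the cases `(a,b,c) = (0,0,-1), (1,1,1), (1,0,0), (0,1,0)`. -/
def bridgeComb (a b c : ℝ) (w : I × I → ℝ) (t : I × I) : ℝ :=
  w t - a * (t.1 * w (1, t.2)) - b * (t.2 * w (t.1, 1)) + c * (t.1 * t.2 * w (1, 1))

/-- The centring of `w` dual to `bridgeComb a b c`: evaluation at the upper end of a variable is
replaced by the mean in that variable. -/
noncomputable def meanComb (a b c : ℝ) (w : I × I → ℝ) (t : I × I) : ℝ :=
  w t - a * (∫ u, w (u, t.2)) - b * (∫ u, w (t.1, u)) + c * ∫ u, w u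

section Grid

variable (n : ℕ)

/-- The index `i` of the cell `(i/(n+1), (i+1)/(n+1)]` containing `t`; the point `0` is put into the
cell of index `0`. -/
noncomputable def gridIdx (t : I) : Fin (n + 1) := Fin.ofNat (n + 1) (⌈((n : ℝ) + 1) * t⌉₊ - 1)

/-- The upper end of the cell of index `i`. -/
noncomputable def gridPt (i : Fin (n + 1)) : I :=
  ⟨((i : ℝ) + 1) / ((n : ℝ) + 1), by
    have : (i : ℝ) ≤ n := by exact_mod_cast Nat.lt_succ_iff.1 i.2
    exact ⟨by positivity, (div_le_one (by positivity)).2 (by linarith)⟩⟩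

theorem gridPt_last : gridPt n (Fin.last n) = 1 := by
  ext
  have : (n : ℝ) + 1 ≠ 0 := by positivity
  simp [gridPt, this]

theorem measurable_gridIdx : Measurable (gridIdx n) := by
  have h : Measurable fun t : I ↦ ⌈((n : ℝ) + 1) * t⌉₊ :=
    Nat.measurable_ceil.comp (by fun_prop)
  exact (measurable_from_top (f := fun k : ℕ ↦ Fin.ofNat (n + 1) (k - 1))).comp h

theorem val_gridIdx (t : I) : (gridIdx n t : ℕ) = ⌈((n : ℝ) + 1) * t⌉₊ - 1 := by
  have h : ⌈((n : ℝ) + 1) * t⌉₊ ≤ n + 1 := by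
    refine Nat.ceil_le.2 ?_
    push_cast
    exact mul_le_of_le_one_right (by positivity) t.2.2
  exact Nat.mod_eq_of_lt (by omega)

theorem le_gridPt_gridIdx (t : I) : (t : ℝ) ≤ gridPt n (gridIdx n t) := by
  have h := Nat.le_ceil (((n : ℝ) + 1) * t)
  have h2 : (⌈((n : ℝ) + 1) * t⌉₊ : ℝ) ≤ (gridIdx n t : ℝ) + 1 := by
    rw [val_gridIdx]; exact_mod_cast (by omega : _ ≤ _)
  simp only [gridPt]
  rw [le_div_iff₀ (by positivity)]
  linarith

theorem gridIdx_div_le (t : I) : ((gridIdx n t : ℕ) : ℝ) / ((n : ℝ) + 1) ≤ t := by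
  rw [div_le_iff₀ (by positivity), val_gridIdx]
  have h := Nat.ceil_lt_add_one (mul_nonneg (by positivity : (0 : ℝ) ≤ (n : ℝ) + 1) t.2.1)
  rcases Nat.eq_zero_or_pos ⌈((n : ℝ) + 1) * t⌉₊ with h0 | h0
  · rw [h0]
    simpa using mul_nonneg t.2.1 (by positivity : (0 : ℝ) ≤ (n : ℝ) + 1)
  · rw [Nat.cast_sub h0]
    push_cast
    linarith

theorem abs_gridPt_gridIdx_sub_le (t : I) :
    |(gridPt n (gridIdx n t) : ℝ) - t| ≤ 1 / ((n : ℝ) + 1) := by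
  rw [abs_of_nonneg (sub_nonneg.2 (le_gridPt_gridIdx n t))]
  have h := gridIdx_div_le n t
  simp only [gridPt, add_div] at h ⊢
  linarith

/-- Each cell has length at most `1 / (n + 1)`, and the `n + 1` lengths add up to `1`. -/
theorem map_gridIdx_real_singleton (i : Fin (n + 1)) :
    ((volume : Measure I).map (gridIdx n)).real {i} = 1 / ((n : ℝ) + 1) := by
  have hp : IsProbabilityMeasure ((volume : Measure I).map (gridIdx n)) :=
    Measure.isProbabilityMeasure_map (measurable_gridIdx n).aemeasurable
  have hle : ∀ i ∈ Finset.univ,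
      ((volume : Measure I).map (gridIdx n)).real {i} ≤ 1 / ((n : ℝ) + 1) := by
    intro i _
    have hN : (0 : ℝ) < (n : ℝ) + 1 := by positivity
    have hi : (i : ℝ) / ((n : ℝ) + 1) ∈ I :=
      ⟨by positivity, (div_le_one hN).2 (by exact_mod_cast i.2.le)⟩
    rw [map_measureReal_apply (measurable_gridIdx n) (measurableSet_singleton i)]
    have hsub : gridIdx n ⁻¹' {i} ⊆ Set.Icc ⟨(i : ℝ) / ((n : ℝ) + 1), hi⟩ (gridPt n i) := by
      rintro t rfl
      exact ⟨gridIdx_div_le n t, le_gridPt_gridIdx n t⟩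
    refine (measureReal_mono hsub).trans ?_
    rw [measureReal_def, unitInterval.volume_Icc, ENNReal.toReal_ofReal]
    · simp only [gridPt]
      rw [← sub_div, add_sub_cancel_left]
    · simp only [gridPt]
      rw [← sub_div, add_sub_cancel_left]
      positivity
  refine (Finset.sum_eq_sum_iff_of_le hle).1 ?_ i (Finset.mem_univ i)
  rw [sum_measureReal_singleton]
  have : (n : ℝ) + 1 ≠ 0 := by positivity
  simp [this]

theorem integral_comp_gridIdx (f : Fin (n + 1) → ℝ) :
    ∫ t, f (gridIdx n t) = 1 / ((n : ℝ) + 1) * ∑ i, f i := by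
  have hp : IsProbabilityMeasure ((volume : Measure I).map (gridIdx n)) :=
    Measure.isProbabilityMeasure_map (measurable_gridIdx n).aemeasurable
  rw [← integral_map (measurable_gridIdx n).aemeasurable (f := f) (by fun_prop),
    integral_fintype .of_finite]
  simp only [map_gridIdx_real_singleton, smul_eq_mul, Finset.mul_sum]

theorem integral_comp_gridIdx_prod (f : Fin (n + 1) → Fin (n + 1) → ℝ) :
    ∫ t : I × I, f (gridIdx n t.1) (gridIdx n t.2) =
      1 / ((n : ℝ) + 1) * ∑ i, 1 / ((n : ℝ) + 1) * ∑ j, f i j := by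
  have hm : Measurable fun t : I × I ↦ (gridIdx n t.1, gridIdx n t.2) :=
    ((measurable_gridIdx n).comp measurable_fst).prodMk ((measurable_gridIdx n).comp measurable_snd)
  have hp : IsProbabilityMeasure ((volume : Measure (I × I)).map
      fun t : I × I ↦ (gridIdx n t.1, gridIdx n t.2)) :=
    Measure.isProbabilityMeasure_map hm.aemeasurable
  have hint : Integrable (fun t : I × I ↦ f (gridIdx n t.1) (gridIdx n t.2)) := by
    have h : Integrable (Function.uncurry f) ((volume : Measure (I × I)).map
      fun t : I × I ↦ (gridIdx n t.1, gridIdx n t.2)) := .of_finite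
    exact h.comp_measurable hm
  rw [Measure.volume_eq_prod] at hint ⊢
  rw [integral_prod _ hint]
  simp only [integral_comp_gridIdx]
  exact integral_comp_gridIdx n fun i ↦ 1 / ((n : ℝ) + 1) * ∑ j, f i j

/-- Both coordinates rounded up to the grid of mesh `1 / (n + 1)`. -/
noncomputable def roundUp (t : I × I) : I × I :=
  (gridPt n (gridIdx n t.1), gridPt n (gridIdx n t.2))

theorem measurable_roundUp : Measurable (roundUp n) :=
  ((measurable_of_finite (gridPt n)).comp ((measurable_gridIdx n).comp measurable_fst)).prodMk
    ((measurable_of_finite (gridPt n)).comp ((measurable_gridIdx n).comp measurable_snd))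

end Grid

/-! ### The identity in law on the grid -/

section DiscreteIdentity

open Matrix
open scoped Kronecker

variable {Ω : Type*} [MeasurableSpace Ω] {P : Measure Ω} {W : I × I → Ω → ℝ}

theorem _root_.ProbabilityTheory.IsGaussianProcess.hasGaussianLaw_pi {T ι : Type*} [Finite ι]
    {X : T → Ω → ℝ} (hX : IsGaussianProcess X P) (f : ι → T) :
    HasGaussianLaw (fun ω i ↦ X (f i) ω) P := by
  classical
  have := Fintype.ofFinite ι
  exact ((hX.comp_right f).hasGaussianLaw Finset.univ).map_fun (ContinuousLinearMap.pi
    fun i ↦ ContinuousLinearMap.proj (⟨i, Finset.mem_univ i⟩ : (Finset.univ : Finset ι)))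

theorem IsBrownianSheet.momentMatrix_grid (hW : IsBrownianSheet W P) (n : ℕ) :
    momentMatrix (fun p : Fin (n + 1) × Fin (n + 1) ↦ W (gridPt n p.1, gridPt n p.2)) P =
      (1 / ((n : ℝ) + 1) ^ 2) •
        ((sumMatrix n ⊗ₖ sumMatrix n) * (sumMatrix n ⊗ₖ sumMatrix n)ᵀ) := by
  ext ⟨i, j⟩ ⟨k, l⟩
  have hN : (0 : ℝ) ≤ (n : ℝ) + 1 := by positivity
  rw [← kroneckerMap_transpose, ← mul_kronecker_mul]
  simp only [momentMatrix, of_apply, hW.covariance, Matrix.smul_apply, kroneckerMap_apply,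
    sumMatrix_mul_transpose, gridPt, min_div_div_right hN, smul_eq_mul]
  generalize (n : ℝ) + 1 = N
  ring

/-- The two step functionals are `∑ (L w)²` and `∑ (Q w)²` up to the same factor, for the vector `w`
of the values of `W` on the grid, `L` the discrete bridge and `Q` the discrete centring. -/
theorem IsBrownianSheet.identDistrib_roundUp (hW : IsBrownianSheet W P) (a b c : ℝ) (n : ℕ) :
    IdentDistrib (fun ω ↦ ∫ t, bridgeComb a b c (W · ω) (roundUp n t) ^ 2)
      (fun ω ↦ ∫ t, meanComb a b c (fun s ↦ W (roundUp n s) ω) t ^ 2) P P := by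
  let g : Fin (n + 1) × Fin (n + 1) → Ω → ℝ := fun p ↦ W (gridPt n p.1, gridPt n p.2)
  have hg : HasGaussianLaw (fun ω ↦ (g · ω)) P := hW.isGaussianProcess.hasGaussianLaw_pi _
  have hg0 : ∀ p, ∫ ω, g p ω ∂P = 0 := fun p ↦ hW.centered _
  have hg2 : ∀ p, MemLp (g p) 2 P := fun p ↦ (hg.eval p).memLp_two
  have hgi : ∀ p, Integrable (g p) P := fun p ↦ (hg.eval p).integrable
  have key := identDistrib_sum_sq
    (hasGaussianLaw_mulVec hg (kroneckerComb a b c (chordMatrix n)))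
    (hasGaussianLaw_mulVec hg (kroneckerComb a b c (meanMatrix n)))
    (integral_mulVec hgi hg0 _) (integral_mulVec hgi hg0 _) (by
      rw [momentMatrix_mulVec hg2, momentMatrix_mulVec hg2, hW.momentMatrix_grid]
      exact charpoly_kroneckerComb n a b c _)
  have key' := key.comp (u := fun x ↦ 1 / ((n : ℝ) + 1) * (1 / ((n : ℝ) + 1) * x)) (by fun_prop)
  convert key' using 1
  · ext ω
    have := integral_comp_gridIdx_prod n fun i j ↦
      (kroneckerComb a b c (chordMatrix n) *ᵥ (g · ω)) (i, j) ^ 2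
    simp only [Function.comp_apply, Fintype.sum_prod_type]
    rw [Finset.mul_sum, ← this]
    congr 1 with t
    rw [kroneckerComb_chordMatrix_mulVec]
    simp only [g, gridPt_last]
    rfl
  · ext ω
    have := integral_comp_gridIdx_prod n fun i j ↦
      (kroneckerComb a b c (meanMatrix n) *ᵥ (g · ω)) (i, j) ^ 2
    simp only [Function.comp_apply, Fintype.sum_prod_type]
    rw [Finset.mul_sum, ← this]
    congr 1 with t
    rw [kroneckerComb_meanMatrix_mulVec, ← integral_comp_gridIdx n fun k ↦ g (k, _) ω,
      ← integral_comp_gridIdx n fun l ↦ g (_, l) ω,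
      ← integral_comp_gridIdx_prod n fun k l ↦ g (k, l) ω]
    rfl

end DiscreteIdentity

/-! ### Square-integrable random fields -/

section Fields

open Filter
open scoped ENNReal Topology

variable {Ω T : Type*} [MeasurableSpace Ω] [MeasurableSpace T] {P : Measure Ω}
  [IsProbabilityMeasure P] {ν : Measure T} [IsProbabilityMeasure ν]

theorem eLpNorm_two_sq {α : Type*} [MeasurableSpace α] (μ : Measure α) (f : α → ℝ) :
    eLpNorm f 2 μ ^ 2 = ∫⁻ x, ‖f x‖ₑ ^ 2 ∂μ := by
  have := eLpNorm_nnreal_pow_eq_lintegral (f := f) (μ := μ) (p := 2) two_ne_zero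
  simpa using this

theorem eLpNorm_two_le_iff {α : Type*} [MeasurableSpace α] {μ : Measure α} {f : α → ℝ} {K : ℝ≥0∞} :
    eLpNorm f 2 μ ≤ K ↔ ∫⁻ x, ‖f x‖ₑ ^ 2 ∂μ ≤ K ^ 2 := by
  rw [← eLpNorm_two_sq, ENNReal.pow_le_pow_left_iff two_ne_zero]

theorem eLpNorm_two_le_of_integral_sq_le {α : Type*} [MeasurableSpace α] {μ : Measure α}
    {f : α → ℝ} (hf : MemLp f 2 μ) {r : ℝ} (hr : 0 ≤ r)
    (h : ∫ ω, f ω ^ 2 ∂μ ≤ r ^ 2) : eLpNorm f 2 μ ≤ ENNReal.ofReal r := by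
  rw [eLpNorm_two_le_iff, ← ENNReal.ofReal_pow hr]
  refine le_trans (le_of_eq ?_) (ENNReal.ofReal_le_ofReal h)
  rw [ofReal_integral_eq_lintegral_ofReal hf.integrable_sq (.of_forall fun _ ↦ sq_nonneg _)]
  congr 1 with ω
  rw [Real.enorm_eq_ofReal_abs, ← ENNReal.ofReal_pow (abs_nonneg _), sq_abs]

theorem eLpNorm_uncurry_le {X : T → Ω → ℝ} (hX : Measurable (Function.uncurry X)) {K : ℝ≥0∞}
    (hK : ∀ t, eLpNorm (X t) 2 P ≤ K) : eLpNorm (Function.uncurry X) 2 (ν.prod P) ≤ K := by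
  rw [eLpNorm_two_le_iff, lintegral_prod _ (by fun_prop)]
  calc ∫⁻ t, ∫⁻ ω, ‖X t ω‖ₑ ^ 2 ∂P ∂ν ≤ ∫⁻ _, K ^ 2 ∂ν :=
        lintegral_mono fun t ↦ eLpNorm_two_le_iff.1 (hK t)
    _ = K ^ 2 := by simp

/-- A measurable field bounded in `L²(P)` uniformly in the parameter has square integrable
paths, by Tonelli's theorem. -/
theorem ae_memLp_path {X : T → Ω → ℝ} (hX : Measurable (Function.uncurry X)) {K : ℝ≥0∞}
    (hK' : K ≠ ∞) (hK : ∀ t, eLpNorm (X t) 2 P ≤ K) : ∀ᵐ ω ∂P, MemLp (X · ω) 2 ν := by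
  have h : ∫⁻ ω, ∫⁻ t, ‖X t ω‖ₑ ^ 2 ∂ν ∂P ≠ ∞ := by
    have h1 := eLpNorm_two_le_iff.1 (eLpNorm_uncurry_le (ν := ν) hX hK)
    rw [lintegral_prod_symm _ (by fun_prop)] at h1
    exact (h1.trans_lt (by finiteness)).ne
  have hm : Measurable fun p : Ω × T ↦ ‖X p.2 p.1‖ₑ ^ 2 :=
    ((hX.comp measurable_swap).enorm).pow_const 2
  filter_upwards [ae_lt_top hm.lintegral_prod_right' h] with ω hω
  have hXω : Measurable (X · ω) := hX.comp (measurable_id.prodMk measurable_const)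
  refine ⟨hXω.aestronglyMeasurable, ?_⟩
  have h2 := eLpNorm_two_sq ν (X · ω)
  by_contra h3
  rw [not_lt, top_le_iff] at h3
  rw [h3] at h2
  exact hω.ne (h2.symm.trans (by simp))

/-- Averaging a field over its parameter does not increase the `L²` norm. -/
theorem eLpNorm_integral_le {X : T → Ω → ℝ} (hX : Measurable (Function.uncurry X)) {K : ℝ≥0∞}
    (hK : ∀ t, eLpNorm (X t) 2 P ≤ K) : eLpNorm (fun ω ↦ ∫ t, X t ω ∂ν) 2 P ≤ K := by
  rw [eLpNorm_two_le_iff]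
  have h1 := eLpNorm_two_le_iff.1 (eLpNorm_uncurry_le (ν := ν) hX hK)
  rw [lintegral_prod_symm _ (by fun_prop)] at h1
  refine le_trans (lintegral_mono fun ω ↦ ?_) h1
  have hXω : Measurable (X · ω) := hX.comp (measurable_id.prodMk measurable_const)
  rw [Function.uncurry_def]
  simp only
  rw [← eLpNorm_two_sq ν (X · ω)]
  gcongr
  calc ‖∫ t, X t ω ∂ν‖ₑ ≤ ∫⁻ t, ‖X t ω‖ₑ ∂ν := enorm_integral_le_lintegral_enorm _
    _ = eLpNorm (X · ω) 1 ν := eLpNorm_one_eq_lintegral_enorm.symm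
    _ ≤ eLpNorm (X · ω) 2 ν :=
        eLpNorm_le_eLpNorm_of_exponent_le one_le_two hXω.aestronglyMeasurable

theorem measurable_integral_sq {X : T → Ω → ℝ} (hX : Measurable (Function.uncurry X)) :
    Measurable fun ω ↦ ∫ t, X t ω ^ 2 ∂ν :=
  ((hX.pow_const 2).stronglyMeasurable.integral_prod_left' (μ := ν)).measurable

/-- Fields that converge in `L²(P)` uniformly in the parameter have square integrals that converge
in `L¹(P)`, by the Cauchy–Schwarz inequality on the product space. -/
theorem tendstoInMeasure_integral_sq {X : T → Ω → ℝ} {Y : ℕ → T → Ω → ℝ}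
    (hX : Measurable (Function.uncurry X)) (hY : ∀ n, Measurable (Function.uncurry (Y n)))
    {K : ℝ≥0∞} (hK' : K ≠ ∞) (hK : ∀ t, eLpNorm (X t) 2 P ≤ K) {ε : ℕ → ℝ≥0∞}
    (hε' : ∀ n, ε n ≠ ∞) (hε : Tendsto ε atTop (𝓝 0))
    (hYX : ∀ n t, eLpNorm (Y n t - X t) 2 P ≤ ε n) :
    TendstoInMeasure P (fun n ω ↦ ∫ t, Y n t ω ^ 2 ∂ν) atTop (fun ω ↦ ∫ t, X t ω ^ 2 ∂ν) := by
  have hXt : ∀ t, Measurable (X t) := fun t ↦ hX.comp (measurable_const.prodMk measurable_id)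
  have hYt : ∀ n t, Measurable (Y n t) := fun n t ↦
    (hY n).comp (measurable_const.prodMk measurable_id)
  have hYK : ∀ n t, eLpNorm (Y n t) 2 P ≤ ε n + K := fun n t ↦ by
    calc eLpNorm (Y n t) 2 P = eLpNorm ((Y n t - X t) + X t) 2 P := by rw [sub_add_cancel]
      _ ≤ eLpNorm (Y n t - X t) 2 P + eLpNorm (X t) 2 P :=
          eLpNorm_add_le ((hYt n t).sub (hXt t)).aestronglyMeasurable
            (hXt t).aestronglyMeasurable one_le_two
      _ ≤ _ := add_le_add (hYX n t) (hK t)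
  refine tendstoInMeasure_of_tendsto_eLpNorm one_ne_zero
    (fun n ↦ (measurable_integral_sq (hY n)).aestronglyMeasurable)
    (measurable_integral_sq hX).aestronglyMeasurable ?_
  have hbound : ∀ n, eLpNorm ((fun ω ↦ ∫ t, Y n t ω ^ 2 ∂ν) - fun ω ↦ ∫ t, X t ω ^ 2 ∂ν) 1 P ≤
      ε n * (ε n + K + K) := by
    intro n
    have hsub := eLpNorm_uncurry_le (ν := ν) (X := fun t ↦ Y n t - X t) ((hY n).sub hX) (hYX n)
    have hadd := eLpNorm_uncurry_le (ν := ν) (P := P) (X := fun t ↦ Y n t + X t) ((hY n).add hX)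
      (K := ε n + K + K) fun t ↦ (eLpNorm_add_le (hYt n t).aestronglyMeasurable
          (hXt t).aestronglyMeasurable one_le_two).trans (add_le_add (hYK n t) (hK t))
    have hmul := eLpNorm_smul_le_mul_eLpNorm (p := 2) (q := 2) (r := 1) (μ := ν.prod P)
      (((hY n).add hX).aestronglyMeasurable) (((hY n).sub hX).aestronglyMeasurable)
    calc eLpNorm ((fun ω ↦ ∫ t, Y n t ω ^ 2 ∂ν) - fun ω ↦ ∫ t, X t ω ^ 2 ∂ν) 1 P
        = ∫⁻ ω, ‖(∫ t, Y n t ω ^ 2 ∂ν) - ∫ t, X t ω ^ 2 ∂ν‖ₑ ∂P := eLpNorm_one_eq_lintegral_enorm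
      _ ≤ ∫⁻ ω, ∫⁻ t, ‖Y n t ω ^ 2 - X t ω ^ 2‖ₑ ∂ν ∂P := by
          refine lintegral_mono_ae ?_
          filter_upwards [ae_memLp_path (ν := ν) hX hK' hK,
            ae_memLp_path (ν := ν) (hY n) (by finiteness [hε' n]) (hYK n)] with ω h1 h2
          rw [← integral_sub h2.integrable_sq h1.integrable_sq]
          exact enorm_integral_le_lintegral_enorm _
      _ = ∫⁻ p, ‖Y n p.1 p.2 ^ 2 - X p.1 p.2 ^ 2‖ₑ ∂(ν.prod P) := by
          rw [lintegral_prod_symm]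
          exact (((hY n).pow_const 2).sub (hX.pow_const 2)).enorm.aemeasurable
      _ = eLpNorm ((Function.uncurry (Y n) - Function.uncurry X) •
            (Function.uncurry (Y n) + Function.uncurry X)) 1 (ν.prod P) := by
          rw [eLpNorm_one_eq_lintegral_enorm]
          congr 1 with p
          congr 1
          simp only [Pi.smul_apply', Pi.sub_apply, Pi.add_apply, smul_eq_mul, Function.uncurry]
          ring
      _ ≤ ε n * (ε n + K + K) := hmul.trans (mul_le_mul' hsub hadd)
  have hlim : Tendsto (fun n ↦ ε n * (ε n + K + K)) atTop (𝓝 0) := by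
    have h1 : Tendsto (fun n ↦ ε n + K + K) atTop (𝓝 (0 + K + K)) :=
      (hε.add tendsto_const_nhds).add tendsto_const_nhds
    have h2 := ENNReal.Tendsto.mul hε (.inr (by finiteness)) h1 (.inr ENNReal.zero_ne_top)
    simpa using h2
  exact tendsto_of_tendsto_of_tendsto_of_le_of_le tendsto_const_nhds hlim (fun _ ↦ zero_le) hbound

end Fields

/-! ### `L²` bounds for bridge and mean combinations -/

section Combinations

open scoped ENNReal

variable {Ω : Type*} [MeasurableSpace Ω] {P : Measure Ω}

theorem eLpNorm_const_mul_le {f : Ω → ℝ} {K : ℝ≥0∞} (h : eLpNorm f 2 P ≤ K) (a : ℝ) :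
    eLpNorm (fun ω ↦ a * f ω) 2 P ≤ ‖a‖ₑ * K :=
  (eLpNorm_const_smul_le (c := a) (f := f)).trans (mul_le_mul' le_rfl h)

theorem eLpNorm_comb_le {x y z w : Ω → ℝ} (hx : Measurable x) (hy : Measurable y)
    (hz : Measurable z) (hw : Measurable w) {K : ℝ≥0∞} (hxK : eLpNorm x 2 P ≤ K)
    (hyK : eLpNorm y 2 P ≤ K) (hzK : eLpNorm z 2 P ≤ K) (hwK : eLpNorm w 2 P ≤ K) (a b c : ℝ) :
    eLpNorm (fun ω ↦ x ω - a * y ω - b * z ω + c * w ω) 2 P ≤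
      (1 + ‖a‖ₑ + ‖b‖ₑ + ‖c‖ₑ) * K := by
  have hy' := hy.const_mul a
  have hz' := hz.const_mul b
  have hw' := hw.const_mul c
  have h1 := eLpNorm_sub_le (μ := P) hx.aestronglyMeasurable hy'.aestronglyMeasurable one_le_two
  have h2 := eLpNorm_sub_le (μ := P) (hx.sub hy').aestronglyMeasurable hz'.aestronglyMeasurable
    one_le_two
  have h3 := eLpNorm_add_le (μ := P) ((hx.sub hy').sub hz').aestronglyMeasurable
    hw'.aestronglyMeasurable one_le_two
  simp only [add_mul, one_mul]
  refine h3.trans (add_le_add (h2.trans (add_le_add (h1.trans (add_le_add hxK ?_)) ?_)) ?_)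
  exacts [eLpNorm_const_mul_le hyK a, eLpNorm_const_mul_le hzK b, eLpNorm_const_mul_le hwK c]

theorem eLpNorm_mul_sub_mul_le {x y : Ω → ℝ} (hx : Measurable x) (hy : Measurable y) {K M : ℝ≥0∞}
    (hxy : eLpNorm (x - y) 2 P ≤ K) (hyM : eLpNorm y 2 P ≤ M) {p : ℝ} (hp : |p| ≤ 1) (q : ℝ) :
    eLpNorm (fun ω ↦ p * x ω - q * y ω) 2 P ≤ K + ‖p - q‖ₑ * M := by
  have hp' : ‖p‖ₑ ≤ 1 := by
    rw [Real.enorm_eq_ofReal_abs]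
    exact ENNReal.ofReal_le_one.2 hp
  have h := eLpNorm_add_le (μ := P) ((hx.sub hy).const_mul p).aestronglyMeasurable
    (hy.const_mul (p - q)).aestronglyMeasurable one_le_two
  have he : (fun ω ↦ p * x ω - q * y ω) =
      (fun ω ↦ p * (x - y) ω) + fun ω ↦ (p - q) * y ω := by
    ext ω; simp only [Pi.add_apply, Pi.sub_apply]; ring
  rw [he]
  refine h.trans (add_le_add ((eLpNorm_const_mul_le hxy p).trans ?_) (eLpNorm_const_mul_le hyM _))
  exact mul_le_of_le_one_left' hp'

variable {X : I × I → Ω → ℝ}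

theorem measurable_uncurry_bridgeComb (hX : Measurable (Function.uncurry X)) (a b c : ℝ) :
    Measurable (Function.uncurry fun t ω ↦ bridgeComb a b c (X · ω) t) := by
  have h1 : Measurable fun p : (I × I) × Ω ↦ X (1, p.1.2) p.2 :=
    hX.comp ((measurable_const.prodMk (measurable_snd.comp measurable_fst)).prodMk measurable_snd)
  have h2 : Measurable fun p : (I × I) × Ω ↦ X (p.1.1, 1) p.2 :=
    hX.comp (((measurable_fst.comp measurable_fst).prodMk measurable_const).prodMk measurable_snd)
  have h3 : Measurable fun p : (I × I) × Ω ↦ X (1, 1) p.2 :=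
    hX.comp (measurable_const.prodMk measurable_snd)
  have h4 : Measurable fun p : (I × I) × Ω ↦ (p.1.1 : ℝ) := by fun_prop
  have h5 : Measurable fun p : (I × I) × Ω ↦ (p.1.2 : ℝ) := by fun_prop
  exact ((hX.sub ((h4.mul h1).const_mul a)).sub ((h5.mul h2).const_mul b)).add
    (((h4.mul h5).mul h3).const_mul c)

theorem measurable_uncurry_meanComb (hX : Measurable (Function.uncurry X)) (a b c : ℝ) :
    Measurable (Function.uncurry fun t ω ↦ meanComb a b c (X · ω) t) := by
  have h1 : Measurable fun p : (I × I) × Ω ↦ ∫ u, X (u, p.1.2) p.2 := by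
    have h : Measurable fun q : ((I × I) × Ω) × I ↦ X (q.2, q.1.1.2) q.1.2 :=
      hX.comp (f := fun q : ((I × I) × Ω) × I ↦ ((q.2, q.1.1.2), q.1.2)) (by fun_prop)
    exact h.stronglyMeasurable.integral_prod_right'.measurable
  have h2 : Measurable fun p : (I × I) × Ω ↦ ∫ u, X (p.1.1, u) p.2 := by
    have h : Measurable fun q : ((I × I) × Ω) × I ↦ X (q.1.1.1, q.2) q.1.2 :=
      hX.comp (f := fun q : ((I × I) × Ω) × I ↦ ((q.1.1.1, q.2), q.1.2)) (by fun_prop)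
    exact h.stronglyMeasurable.integral_prod_right'.measurable
  have h3 : Measurable fun p : (I × I) × Ω ↦ ∫ u, X u p.2 := by
    have h : Measurable fun q : ((I × I) × Ω) × (I × I) ↦ X q.2 q.1.2 :=
      hX.comp (f := fun q : ((I × I) × Ω) × (I × I) ↦ (q.2, q.1.2)) (by fun_prop)
    exact h.stronglyMeasurable.integral_prod_right'.measurable
  exact ((hX.sub (h1.const_mul a)).sub (h2.const_mul b)).add (h3.const_mul c)

variable [IsProbabilityMeasure P]

theorem eLpNorm_meanComb_le (hX : Measurable (Function.uncurry X)) {K : ℝ≥0∞}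
    (hK : ∀ t, eLpNorm (X t) 2 P ≤ K) (a b c : ℝ) (t : I × I) :
    eLpNorm (fun ω ↦ meanComb a b c (X · ω) t) 2 P ≤ (1 + ‖a‖ₑ + ‖b‖ₑ + ‖c‖ₑ) * K := by
  have h1 : Measurable (Function.uncurry fun (u : I) (ω : Ω) ↦ X (u, t.2) ω) :=
    hX.comp (f := fun q : I × Ω ↦ ((q.1, t.2), q.2)) (by fun_prop)
  have h2 : Measurable (Function.uncurry fun (u : I) (ω : Ω) ↦ X (t.1, u) ω) :=
    hX.comp (f := fun q : I × Ω ↦ ((t.1, q.1), q.2)) (by fun_prop)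
  exact eLpNorm_comb_le (hX.comp (measurable_const.prodMk measurable_id))
    h1.stronglyMeasurable.integral_prod_left'.measurable
    h2.stronglyMeasurable.integral_prod_left'.measurable
    hX.stronglyMeasurable.integral_prod_left'.measurable
    (hK t) (eLpNorm_integral_le h1 fun u ↦ hK _) (eLpNorm_integral_le h2 fun u ↦ hK _)
    (eLpNorm_integral_le hX hK) a b c

/-- `meanComb` is linear on paths for which the integrals in it exist. -/
theorem meanComb_sub_ae {Y : I × I → Ω → ℝ} (hX : Measurable (Function.uncurry X))
    (hY : Measurable (Function.uncurry Y)) {K M : ℝ≥0∞} (hK' : K ≠ ∞) (hM' : M ≠ ∞)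
    (hK : ∀ t, eLpNorm (X t) 2 P ≤ K) (hM : ∀ t, eLpNorm (Y t) 2 P ≤ M) (a b c : ℝ) (t : I × I) :
    (fun ω ↦ meanComb a b c (fun s ↦ Y s ω - X s ω) t) =ᵐ[P]
      (fun ω ↦ meanComb a b c (Y · ω) t) - fun ω ↦ meanComb a b c (X · ω) t := by
  have h1 : Measurable fun q : I × Ω ↦ ((q.1, t.2), q.2) := by fun_prop
  have h2 : Measurable fun q : I × Ω ↦ ((t.1, q.1), q.2) := by fun_prop
  filter_upwards [ae_memLp_path (ν := volume) hX hK' hK, ae_memLp_path (ν := volume) hY hM' hM,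
    ae_memLp_path (ν := volume) (X := fun u : I ↦ X (u, t.2)) (hX.comp h1) hK' fun _ ↦ hK _,
    ae_memLp_path (ν := volume) (X := fun u : I ↦ Y (u, t.2)) (hY.comp h1) hM' fun _ ↦ hM _,
    ae_memLp_path (ν := volume) (X := fun u : I ↦ X (t.1, u)) (hX.comp h2) hK' fun _ ↦ hK _,
    ae_memLp_path (ν := volume) (X := fun u : I ↦ Y (t.1, u)) (hY.comp h2) hM' fun _ ↦ hM _]
    with ω i1 i2 i3 i4 i5 i6
  simp only [meanComb, Pi.sub_apply]
  rw [integral_sub (i2.integrable one_le_two) (i1.integrable one_le_two),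
    integral_sub (i4.integrable one_le_two) (i3.integrable one_le_two),
    integral_sub (i6.integrable one_le_two) (i5.integrable one_le_two)]
  ring

end Combinations

/-! ### Estimates for the Brownian sheet and the limit of vanishing mesh -/

section Sheet

open Filter
open scoped ENNReal Topology

variable {Ω : Type*} [MeasurableSpace Ω] {P : Measure Ω} {W : I × I → Ω → ℝ}

theorem IsBrownianSheet.memLp (hW : IsBrownianSheet W P) (t : I × I) : MemLp (W t) 2 P :=
  (hW.isGaussianProcess.hasGaussianLaw_eval t).memLp_two

theorem IsBrownianSheet.eLpNorm_le_one (hW : IsBrownianSheet W P) (t : I × I) :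
    eLpNorm (W t) 2 P ≤ 1 := by
  have h := eLpNorm_two_le_of_integral_sq_le (hW.memLp t) zero_le_one (by
    have := hW.covariance t t
    simp only [min_self, ← sq] at this
    rw [this, one_pow]
    exact mul_le_one₀ t.1.2.2 t.2.2.1 t.2.2.2)
  simpa using h

/-- The variance of an increment is the area of the symmetric difference of `[0,s]` and `[0,t]`. -/
theorem IsBrownianSheet.eLpNorm_sub_le (hW : IsBrownianSheet W P) (s t : I × I) :
    eLpNorm (W s - W t) 2 P ≤
      ENNReal.ofReal √(|(s.1 : ℝ) - t.1| + |(s.2 : ℝ) - t.2|) := by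
  refine eLpNorm_two_le_of_integral_sq_le ((hW.memLp s).sub (hW.memLp t)) (Real.sqrt_nonneg _) ?_
  rw [Real.sq_sqrt (by positivity)]
  have hi : ∀ p q, Integrable (fun ω ↦ W p ω * W q ω) P := fun p q ↦
    (hW.memLp p).integrable_mul (hW.memLp q)
  have h : ∫ ω, (W s - W t) ω ^ 2 ∂P = ∫ ω, (W s ω * W s ω - 2 * (W s ω * W t ω)
      + W t ω * W t ω) ∂P := by
    congr 1 with ω; simp only [Pi.sub_apply]; ring
  have hi2 : Integrable (fun ω ↦ W s ω * W s ω - 2 * (W s ω * W t ω)) P :=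
    (hi s s).sub ((hi s t).const_mul 2)
  rw [h, integral_add hi2 (hi t t),
    integral_sub (hi s s) ((hi s t).const_mul 2), integral_const_mul, hW.covariance,
    hW.covariance, hW.covariance]
  obtain ⟨⟨s1, hs1, hs1'⟩, ⟨s2, hs2, hs2'⟩⟩ := s
  obtain ⟨⟨t1, ht1, ht1'⟩, ⟨t2, ht2, ht2'⟩⟩ := t
  simp only [min_self]
  rcases le_total s1 t1 with h1 | h1 <;> rcases le_total s2 t2 with h2 | h2 <;>
    simp only [h1, h2, min_eq_left, min_eq_right, abs_of_nonneg, abs_of_nonpos, sub_nonneg,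
      sub_nonpos] <;>
    nlinarith [mul_nonneg (sub_nonneg.2 h1) (sub_nonneg.2 hs2'),
      mul_nonneg (sub_nonneg.2 h1) (sub_nonneg.2 ht2'),
      mul_nonneg (sub_nonneg.2 h2) (sub_nonneg.2 hs1'),
      mul_nonneg (sub_nonneg.2 h2) (sub_nonneg.2 ht1')]

theorem IsBrownianSheet.congr {W' : I × I → Ω → ℝ} (hW : IsBrownianSheet W P)
    (h : ∀ᵐ ω ∂P, ∀ t, W t ω = W' t ω) : IsBrownianSheet W' P where
  isGaussianProcess := hW.isGaussianProcess.congr fun t ↦ h.mono fun _ hω ↦ hω t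
  centered t := by
    rw [← hW.centered t]
    exact integral_congr_ae (h.mono fun _ hω ↦ (hω t).symm)
  covariance t s := by
    rw [← hW.covariance t s]
    refine integral_congr_ae (h.mono fun _ hω ↦ ?_)
    simp only [hω]

/-- Replacing `W` by a jointly measurable field with the same paths is harmless, since all
the functionals considered depend on the path only. -/
theorem IsBrownianSheet.exists_measurable (hW : IsBrownianSheet W P)
    (hmeas : HasMeasurablePaths W P) : ∃ W' : I × I → Ω → ℝ, IsBrownianSheet W' P ∧
      Measurable (Function.uncurry W') ∧ ∀ᵐ ω ∂P, (W' · ω) = (W · ω) := by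
  obtain ⟨W', hm, h⟩ := hmeas
  exact ⟨W', hW.congr h, hm, h.mono fun _ hω ↦ funext fun t ↦ (hω t).symm⟩

/-- A bound for the `L²` norm of the increments of the sheet over one cell of the grid of mesh
`1 / (n + 1)`. -/
noncomputable def gridBound (n : ℕ) : ℝ := √(1 / ((n : ℝ) + 1) + 1 / ((n : ℝ) + 1))

theorem tendsto_gridBound : Tendsto (fun n ↦ ENNReal.ofReal (gridBound n)) atTop (𝓝 0) := by
  have h := (tendsto_one_div_add_atTop_nhds_zero_nat (𝕜 := ℝ)).add
    (tendsto_one_div_add_atTop_nhds_zero_nat (𝕜 := ℝ))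
  have h2 := ENNReal.tendsto_ofReal ((Real.continuous_sqrt.tendsto _).comp h)
  simpa [gridBound, Function.comp_def] using h2

theorem one_div_le_gridBound (n : ℕ) : 1 / ((n : ℝ) + 1) ≤ gridBound n := by
  refine Real.le_sqrt_of_sq_le ?_
  have h0 : 0 ≤ 1 / ((n : ℝ) + 1) := by positivity
  have h1 : 1 / ((n : ℝ) + 1) ≤ 1 := (div_le_one (by positivity)).2 (by simp)
  nlinarith

theorem enorm_gridPt_sub_le (n : ℕ) (t : I) :
    ‖(gridPt n (gridIdx n t) : ℝ) - t‖ₑ ≤ ENNReal.ofReal (gridBound n) := by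
  rw [Real.enorm_eq_ofReal_abs]
  exact ENNReal.ofReal_le_ofReal
    ((abs_gridPt_gridIdx_sub_le n t).trans (one_div_le_gridBound n))

theorem IsBrownianSheet.eLpNorm_sub_le_gridBound (hW : IsBrownianSheet W P) {n : ℕ} {s t : I × I}
    (h1 : |(s.1 : ℝ) - t.1| ≤ 1 / ((n : ℝ) + 1)) (h2 : |(s.2 : ℝ) - t.2| ≤ 1 / ((n : ℝ) + 1)) :
    eLpNorm (W s - W t) 2 P ≤ ENNReal.ofReal (gridBound n) :=
  (hW.eLpNorm_sub_le s t).trans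
    (ENNReal.ofReal_le_ofReal (Real.sqrt_le_sqrt (add_le_add h1 h2)))

theorem IsBrownianSheet.eLpNorm_roundUp_sub_le (hW : IsBrownianSheet W P) (n : ℕ) (t : I × I) :
    eLpNorm (W (roundUp n t) - W t) 2 P ≤ ENNReal.ofReal (gridBound n) :=
  hW.eLpNorm_sub_le_gridBound (abs_gridPt_gridIdx_sub_le n _) (abs_gridPt_gridIdx_sub_le n _)

theorem IsBrownianSheet.eLpNorm_bridgeComb_le (hW : IsBrownianSheet W P)
    (hm : ∀ t, Measurable (W t)) (a b c : ℝ) (t : I × I) :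
    eLpNorm (fun ω ↦ bridgeComb a b c (W · ω) t) 2 P ≤ (1 + ‖a‖ₑ + ‖b‖ₑ + ‖c‖ₑ) * 1 := by
  have key : ∀ (r : ℝ) (s : I × I), 0 ≤ r → r ≤ 1 → eLpNorm (fun ω ↦ r * W s ω) 2 P ≤ 1 := by
    intro r s h0 h1
    refine (eLpNorm_const_mul_le (hW.eLpNorm_le_one s) r).trans ?_
    rw [mul_one, Real.enorm_eq_ofReal_abs, abs_of_nonneg h0]
    exact ENNReal.ofReal_le_one.2 h1
  exact eLpNorm_comb_le (hm _) ((hm _).const_mul _) ((hm _).const_mul _) ((hm _).const_mul _)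
    (hW.eLpNorm_le_one t) (key _ _ t.1.2.1 t.1.2.2) (key _ _ t.2.2.1 t.2.2.2)
    (key _ _ (mul_nonneg t.1.2.1 t.2.2.1) (mul_le_one₀ t.1.2.2 t.2.2.1 t.2.2.2)) a b c

theorem IsBrownianSheet.eLpNorm_bridgeComb_roundUp_sub_le (hW : IsBrownianSheet W P)
    (hm : ∀ t, Measurable (W t)) (a b c : ℝ) (n : ℕ) (t : I × I) :
    eLpNorm ((fun ω ↦ bridgeComb a b c (W · ω) (roundUp n t)) -
      fun ω ↦ bridgeComb a b c (W · ω) t) 2 P ≤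
      (1 + ‖a‖ₑ + ‖b‖ₑ + ‖c‖ₑ) * (2 * ENNReal.ofReal (gridBound n)) := by
  set δ := ENNReal.ofReal (gridBound n) with hδ
  have h0 : |((1 : I) : ℝ) - (1 : I)| ≤ 1 / ((n : ℝ) + 1) := by simp; positivity
  have hI : ∀ x : I, |(x : ℝ)| ≤ 1 := fun x ↦ abs_le.2 ⟨by linarith [x.2.1], x.2.2⟩
  set s := roundUp n t with hs
  have d1 : |(s.1 : ℝ) - t.1| ≤ 1 / ((n : ℝ) + 1) := abs_gridPt_gridIdx_sub_le n t.1
  have d2 : |(s.2 : ℝ) - t.2| ≤ 1 / ((n : ℝ) + 1) := abs_gridPt_gridIdx_sub_le n t.2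
  have e1 : ‖(s.1 : ℝ) - t.1‖ₑ ≤ δ := enorm_gridPt_sub_le n t.1
  have e2 : ‖(s.2 : ℝ) - t.2‖ₑ ≤ δ := enorm_gridPt_sub_le n t.2
  have b1 : eLpNorm (W s - W t) 2 P ≤ 2 * δ :=
    (hW.eLpNorm_roundUp_sub_le n t).trans (le_mul_of_one_le_left' one_le_two)
  have b2 : eLpNorm (fun ω ↦ s.1 * W (1, s.2) ω - t.1 * W (1, t.2) ω) 2 P ≤ 2 * δ := by
    refine (eLpNorm_mul_sub_mul_le (hm _) (hm _)
      (hW.eLpNorm_sub_le_gridBound (s := (1, s.2)) (t := (1, t.2)) h0 d2)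
      (hW.eLpNorm_le_one _) (hI s.1) t.1).trans ?_
    rw [mul_one, two_mul]
    exact add_le_add le_rfl e1
  have b3 : eLpNorm (fun ω ↦ s.2 * W (s.1, 1) ω - t.2 * W (t.1, 1) ω) 2 P ≤ 2 * δ := by
    refine (eLpNorm_mul_sub_mul_le (hm _) (hm _)
      (hW.eLpNorm_sub_le_gridBound (s := (s.1, 1)) (t := (t.1, 1)) d1 h0)
      (hW.eLpNorm_le_one _) (hI s.2) t.2).trans ?_
    rw [mul_one, two_mul]
    exact add_le_add le_rfl e2
  have b4 : eLpNorm (fun ω ↦ s.1 * s.2 * W (1, 1) ω - t.1 * t.2 * W (1, 1) ω) 2 P ≤ 2 * δ := by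
    refine (eLpNorm_mul_sub_mul_le (hm _) (hm _) (K := 0) (by simp) (hW.eLpNorm_le_one _)
      (by rw [abs_mul]; exact mul_le_one₀ (hI _) (abs_nonneg _) (hI _)) _).trans ?_
    have hsplit : (s.1 : ℝ) * s.2 - t.1 * t.2 = s.1 * (s.2 - t.2) + (s.1 - t.1) * t.2 := by ring
    have hI' : ∀ x : I, ‖(x : ℝ)‖ₑ ≤ 1 := fun x ↦ by
      rw [Real.enorm_eq_ofReal_abs]; exact ENNReal.ofReal_le_one.2 (hI x)
    rw [zero_add, mul_one, hsplit, two_mul]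
    refine (enorm_add_le _ _).trans (add_le_add ?_ ?_)
    · rw [enorm_mul]
      exact (mul_le_of_le_one_left' (hI' _)).trans e2
    · rw [enorm_mul]
      exact (mul_le_of_le_one_right' (hI' _)).trans e1
  have := eLpNorm_comb_le ((hm s).sub (hm t))
    (((hm (1, s.2)).const_mul s.1).sub ((hm (1, t.2)).const_mul t.1))
    (((hm (s.1, 1)).const_mul s.2).sub ((hm (t.1, 1)).const_mul t.2))
    (((hm (1, 1)).const_mul (s.1 * s.2)).sub ((hm (1, 1)).const_mul (t.1 * t.2))) b1 b2 b3 b4 a b c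
  refine le_of_eq_of_le ?_ this
  congr 1
  ext ω
  simp only [bridgeComb, Pi.sub_apply]
  ring

variable [IsProbabilityMeasure P]

/-- The identity in law for the discretized fields passes to the limit of vanishing mesh. -/
theorem IsBrownianSheet.identDistrib_of_measurable (hW : IsBrownianSheet W P)
    (hm : Measurable (Function.uncurry W)) (a b c : ℝ) :
    IdentDistrib (fun ω ↦ ∫ t, bridgeComb a b c (W · ω) t ^ 2)
      (fun ω ↦ ∫ t, meanComb a b c (W · ω) t ^ 2) P P := by
  have hWt : ∀ t, Measurable (W t) := fun t ↦ hm.comp (measurable_const.prodMk measurable_id)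
  have hround : ∀ n, Measurable fun p : (I × I) × Ω ↦ (roundUp n p.1, p.2) := fun n ↦
    ((measurable_roundUp n).comp measurable_fst).prodMk measurable_snd
  have hWn : ∀ n, Measurable (Function.uncurry fun t ↦ W (roundUp n t)) := fun n ↦
    hm.comp (hround n)
  have hC : 1 + ‖a‖ₑ + ‖b‖ₑ + ‖c‖ₑ ≠ ∞ := by finiteness
  have hlim : ∀ r : ℝ≥0∞, r ≠ ∞ → Tendsto (fun n ↦ (1 + ‖a‖ₑ + ‖b‖ₑ + ‖c‖ₑ) *
      (r * ENNReal.ofReal (gridBound n))) atTop (𝓝 0) := by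
    intro r hr
    have h1 := ENNReal.Tendsto.const_mul (a := r) tendsto_gridBound (.inr hr)
    rw [mul_zero] at h1
    have h2 := ENNReal.Tendsto.const_mul (a := 1 + ‖a‖ₑ + ‖b‖ₑ + ‖c‖ₑ) h1 (.inr hC)
    rwa [mul_zero] at h2
  have hBm := measurable_uncurry_bridgeComb hm a b c
  have hBmn : ∀ n, Measurable (Function.uncurry
      fun t ω ↦ bridgeComb a b c (W · ω) (roundUp n t)) := fun n ↦ hBm.comp (hround n)
  have hMm := measurable_uncurry_meanComb hm a b c
  have hMmn := fun n ↦ measurable_uncurry_meanComb (hWn n) a b c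
  have hB : TendstoInMeasure P
      (fun n ω ↦ ∫ t, bridgeComb a b c (W · ω) (roundUp n t) ^ 2) atTop
      (fun ω ↦ ∫ t, bridgeComb a b c (W · ω) t ^ 2) :=
    tendstoInMeasure_integral_sq hBm hBmn (by finiteness)
      (hW.eLpNorm_bridgeComb_le hWt a b c) (fun n ↦ by finiteness) (hlim 2 (by finiteness))
      (hW.eLpNorm_bridgeComb_roundUp_sub_le hWt a b c)
  have hM : TendstoInMeasure P
      (fun n ω ↦ ∫ t, meanComb a b c (fun s ↦ W (roundUp n s) ω) t ^ 2) atTop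
      (fun ω ↦ ∫ t, meanComb a b c (W · ω) t ^ 2) := by
    refine tendstoInMeasure_integral_sq hMm hMmn (by finiteness)
      (eLpNorm_meanComb_le hm hW.eLpNorm_le_one a b c) (fun n ↦ by finiteness)
      (hlim 1 (by finiteness)) fun n t ↦ ?_
    -- The error is itself a `meanComb`, of the small field `W (roundUp n s) - W s`.
    have hae := meanComb_sub_ae hm (hWn n) ENNReal.one_ne_top ENNReal.one_ne_top
      hW.eLpNorm_le_one (fun t ↦ hW.eLpNorm_le_one (roundUp n t)) a b c t
    rw [← eLpNorm_congr_ae hae, one_mul]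
    exact eLpNorm_meanComb_le (X := fun s ω ↦ W (roundUp n s) ω - W s ω) ((hWn n).sub hm)
      (hW.eLpNorm_roundUp_sub_le n) a b c t
  have hBd := hB.tendstoInDistribution fun n ↦ (measurable_integral_sq (hBmn n)).aemeasurable
  have hMd := hM.tendstoInDistribution fun n ↦ (measurable_integral_sq (hMmn n)).aemeasurable
  -- The discretized bridges have the same laws as the discretized centrings, so they converge in
  -- distribution to the limits of both sequences.
  have hMd' : TendstoInDistribution
      (fun n ω ↦ ∫ t, bridgeComb a b c (W · ω) (roundUp n t) ^ 2) atTop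
      (fun ω ↦ ∫ t, meanComb a b c (W · ω) t ^ 2) (fun _ ↦ P) P := by
    refine ⟨hBd.forall_aemeasurable, hMd.aemeasurable_limit, hMd.tendsto.congr fun n ↦ ?_⟩
    exact Subtype.ext (hW.identDistrib_roundUp a b c n).map_eq.symm
  exact ⟨hBd.aemeasurable_limit, hMd.aemeasurable_limit,
    tendstoInDistribution_unique _ hBd hMd'⟩

theorem IsBrownianSheet.hasSquareIntegrablePaths (hW : IsBrownianSheet W P)
    (hmeas : HasMeasurablePaths W P) : HasSquareIntegrablePaths W P := by
  obtain ⟨W', hW', hm, h⟩ := hW.exists_measurable hmeas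
  filter_upwards [h, ae_memLp_path (ν := volume) hm ENNReal.one_ne_top hW'.eLpNorm_le_one]
    with ω h1 h2
  rwa [← h1]

theorem IsBrownianSheet.hasSquareIntegrablePaths_bridgeComb (hW : IsBrownianSheet W P)
    (hmeas : HasMeasurablePaths W P) (a b c : ℝ) :
    HasSquareIntegrablePaths (fun t ω ↦ bridgeComb a b c (W · ω) t) P := by
  obtain ⟨W', hW', hm, h⟩ := hW.exists_measurable hmeas
  filter_upwards [h, ae_memLp_path (ν := volume) (measurable_uncurry_bridgeComb hm a b c)
    (by finiteness) (hW'.eLpNorm_bridgeComb_le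
      (fun t ↦ hm.comp (measurable_const.prodMk measurable_id)) a b c)] with ω h1 h2
  rwa [← h1]

theorem IsBrownianSheet.hasSquareIntegrablePaths_meanComb (hW : IsBrownianSheet W P)
    (hmeas : HasMeasurablePaths W P) (a b c : ℝ) :
    HasSquareIntegrablePaths (fun t ω ↦ meanComb a b c (W · ω) t) P := by
  obtain ⟨W', hW', hm, h⟩ := hW.exists_measurable hmeas
  filter_upwards [h, ae_memLp_path (ν := volume) (measurable_uncurry_meanComb hm a b c)
    (by finiteness) (eLpNorm_meanComb_le hm hW'.eLpNorm_le_one a b c)] with ω h1 h2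
  rwa [← h1]

theorem IsBrownianSheet.identDistrib (hW : IsBrownianSheet W P) (hmeas : HasMeasurablePaths W P)
    (a b c : ℝ) :
    IdentDistrib (fun ω ↦ ∫ t, bridgeComb a b c (W · ω) t ^ 2)
      (fun ω ↦ ∫ t, meanComb a b c (W · ω) t ^ 2) P P := by
  obtain ⟨W', hW', hm, h⟩ := hW.exists_measurable hmeas
  have hI := hW'.identDistrib_of_measurable hm a b c
  have h1 : (fun ω ↦ ∫ t, bridgeComb a b c (W' · ω) t ^ 2) =ᵐ[P]
      fun ω ↦ ∫ t, bridgeComb a b c (W · ω) t ^ 2 := h.mono fun ω hω ↦ by simp only [hω]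
  have h2 : (fun ω ↦ ∫ t, meanComb a b c (W' · ω) t ^ 2) =ᵐ[P]
      fun ω ↦ ∫ t, meanComb a b c (W · ω) t ^ 2 := h.mono fun ω hω ↦ by simp only [hω]
  exact (IdentDistrib.of_ae_eq hI.aemeasurable_fst h1).symm.trans
    (hI.trans (IdentDistrib.of_ae_eq hI.aemeasurable_snd h2))

end Sheet

/-! ### The named fields as combinations -/

section NamedFields

variable {Ω : Type*}

theorem bridge_eq_bridgeComb (W : I × I → Ω → ℝ) :
    bridge W = fun t ω ↦ bridgeComb 0 0 (-1) (W · ω) t := by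
  ext t ω; simp only [bridge, bridgeComb]; ring

theorem tiedDownBridge_eq_bridgeComb (W : I × I → Ω → ℝ) :
    tiedDownBridge W = fun t ω ↦ bridgeComb 1 1 1 (W · ω) t := by
  ext t ω; simp only [tiedDownBridge, bridgeComb]; ring

theorem kieferOne_eq_bridgeComb (W : I × I → Ω → ℝ) :
    kieferOne W = fun t ω ↦ bridgeComb 1 0 0 (W · ω) t := by
  ext t ω; simp only [kieferOne, bridgeComb]; ring

theorem kieferTwo_eq_bridgeComb (W : I × I → Ω → ℝ) :
    kieferTwo W = fun t ω ↦ bridgeComb 0 1 0 (W · ω) t := by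
  ext t ω; simp only [kieferTwo, bridgeComb]; ring

theorem centred_eq_meanComb (W : I × I → Ω → ℝ) :
    centred W = fun t ω ↦ meanComb 0 0 (-1) (W · ω) t := by
  ext t ω; simp only [centred, meanComb]; ring

theorem doublyCentred_eq_meanComb (W : I × I → Ω → ℝ) :
    doublyCentred W = fun t ω ↦ meanComb 1 1 1 (W · ω) t := by
  ext t ω; simp only [doublyCentred, meanComb]; ring

theorem centredOne_eq_meanComb (W : I × I → Ω → ℝ) :
    centredOne W = fun t ω ↦ meanComb 1 0 0 (W · ω) t := by
  ext t ω; simp only [centredOne, meanComb]; ring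

theorem centredTwo_eq_meanComb (W : I × I → Ω → ℝ) :
    centredTwo W = fun t ω ↦ meanComb 0 1 0 (W · ω) t := by
  ext t ω; simp only [centredTwo, meanComb]; ring

end NamedFields

end BrownianSheet

theorem corollary2 {Ω : Type*} [MeasurableSpace Ω] (P : Measure Ω) [IsProbabilityMeasure P]
    (W : I × I → Ω → ℝ) (hW : IsBrownianSheet W P) (hmeas : HasMeasurablePaths W P) :
    -- almost surely, all the path integrals below exist
    (HasSquareIntegrablePaths W P ∧
      (∀ᵐ ω ∂P, ∀ᵐ t₁ : I, Integrable (fun u₂ : I ↦ W (t₁, u₂) ω)) ∧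
      (∀ᵐ ω ∂P, ∀ᵐ t₂ : I, Integrable (fun u₁ : I ↦ W (u₁, t₂) ω)) ∧
      HasSquareIntegrablePaths (bridge W) P ∧ HasSquareIntegrablePaths (centred W) P ∧
      HasSquareIntegrablePaths (tiedDownBridge W) P ∧
      HasSquareIntegrablePaths (doublyCentred W) P ∧
      HasSquareIntegrablePaths (kieferOne W) P ∧ HasSquareIntegrablePaths (centredOne W) P ∧
      HasSquareIntegrablePaths (kieferTwo W) P ∧ HasSquareIntegrablePaths (centredTwo W) P) ∧
    -- the four identities in law
    IdentDistrib (fun ω ↦ ∫ t : I × I, bridge W t ω ^ 2)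
      (fun ω ↦ ∫ t : I × I, centred W t ω ^ 2) P P ∧
    IdentDistrib (fun ω ↦ ∫ t : I × I, tiedDownBridge W t ω ^ 2)
      (fun ω ↦ ∫ t : I × I, doublyCentred W t ω ^ 2) P P ∧
    IdentDistrib (fun ω ↦ ∫ t : I × I, kieferOne W t ω ^ 2)
      (fun ω ↦ ∫ t : I × I, centredOne W t ω ^ 2) P P ∧
    IdentDistrib (fun ω ↦ ∫ t : I × I, kieferTwo W t ω ^ 2)
      (fun ω ↦ ∫ t : I × I, centredTwo W t ω ^ 2) P P := by
  have hsq := hW.hasSquareIntegrablePaths hmeas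
  have hB := hW.hasSquareIntegrablePaths_bridgeComb hmeas
  have hM := hW.hasSquareIntegrablePaths_meanComb hmeas
  have hI := hW.identDistrib hmeas
  simp only [bridge_eq_bridgeComb, tiedDownBridge_eq_bridgeComb, kieferOne_eq_bridgeComb,
    kieferTwo_eq_bridgeComb, centred_eq_meanComb, doublyCentred_eq_meanComb,
    centredOne_eq_meanComb, centredTwo_eq_meanComb]
  refine ⟨⟨hsq, hsq.mono fun ω hω ↦ ?_, hsq.mono fun ω hω ↦ ?_, hB _ _ _, hM _ _ _, hB _ _ _,
    hM _ _ _, hB _ _ _, hM _ _ _, hB _ _ _, hM _ _ _⟩, hI _ _ _, hI _ _ _, hI _ _ _, hI _ _ _⟩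
  · have h := hω.integrable one_le_two
    rw [Measure.volume_eq_prod] at h
    exact h.prod_right_ae
  · have h := hω.integrable one_le_two
    rw [Measure.volume_eq_prod] at h
    exact h.prod_left_ae
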